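/- Let $H_1, H_2$ be Hilbert spaces (both real or both complex) and let $J : H_1 \to H_2$ be an injective bounded linear operator. For $j = 1, 2$ let $A_j$ be a (possibly unbounded) lower semibounded self-adjoint operator on $H_j$, and let $q_j$, with domain $D(q_j) \supseteq D(A_j)$, be the associated closed quadratic form, i.e. the closure of the form $x \mapsto \langle A_j x, x\rangle$ on $D(A_j)$. Suppose that $A_2$ has discrete spectrum, i.e. every point of its spectrum is an isolated point of the spectrum and an eigenvalue of finite multiplicity. Assume that there are constants $\alpha, \beta > 0$ such that (i) $\|Jx\|_{H_2}^2 \ge \alpha \|x\|_{H_1}^2$ for all $x \in H_1$; (ii) $Jx \in D(q_2)$ and $q_2(Jx) \le \beta\, q_1(x)$ for all $x \in D(q_1)$. Then $A_1$ has discrete spectrum. Moreover, if $\lambda_1(A_j) \le \lambda_2(A_j) \le \dots$ denote the eigenvalues of $A_j$ in increasing order, counted with multiplicities, then $$\lambda_k(A_2) \le \frac{\beta}{\alpha}\, \lambda_k(A_1)$$ for every integer $k \ge 1$ with $k \le \dim H_1$ and $\lambda_k(A_1) \ge 0$. In particular, the inequality holds for all $1 \le k \le \dim H_1$ if $A_1$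 is nonnegative. -/

import Mathlib

open Filter Topology

namespace SelfAdjointForm

noncomputable section

variable {𝕜 H : Type*} [RCLike 𝕜] [NormedAddCommGroup H] [InnerProductSpace 𝕜 H]

/-- The quadratic form `⟨A x, x⟩` of an operator `A`, on the operator domain `D(A)`.
(For a symmetric operator `⟨A x, x⟩` is real, so taking the real part loses nothing.) -/
def preForm (A : H →ₗ.[𝕜] H) (x : A.domain) : ℝ :=
  RCLike.re (inner 𝕜 (A x) (x : H))

/-- `A` is lower semibounded: `⟨A x, x⟩ ≥ c ‖x‖²` on `D(A)` for some real `c`. -/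
def LowerSemibounded (A : H →ₗ.[𝕜] H) : Prop :=
  ∃ c : ℝ, ∀ x : A.domain, c * ‖(x : H)‖ ^ 2 ≤ preForm A x

/-- The sequence `u` in `D(A)` converges to `x` in `H` and is Cauchy for the form of `A`. -/
def FormApprox (A : H →ₗ.[𝕜] H) (u : ℕ → A.domain) (x : H) : Prop :=
  Tendsto (fun n => (u n : H)) atTop (𝓝 x) ∧
    Tendsto (fun p : ℕ × ℕ => preForm A (u p.1 - u p.2)) atTop (𝓝 0)

/-- The domain `D(q)` of the closed quadratic form `q` associated with a lower semibounded
self-adjoint operator `A`; `q` is the closure of `x ↦ ⟨A x, x⟩` on `D(A)`. -/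
def formDomain (A : H →ₗ.[𝕜] H) : Set H :=
  {x | ∃ u : ℕ → A.domain, FormApprox A u x}

open Classical in
/-- The quadratic form `q` associated with a lower semibounded self-adjoint operator `A`: for
`x ∈ D(q)`, the limit of `⟨A uₙ, uₙ⟩` along a sequence `u` as in `FormApprox`. The limit exists
and does not depend on the sequence, see `FormApprox.tendsto_form`. -/
def form (A : H →ₗ.[𝕜] H) (x : H) : ℝ :=
  if h : ∃ u : ℕ → A.domain, FormApprox A u x then
    limUnder atTop (fun n => preForm A (h.choose n))
  else 0

/-- For a lower semibounded self-adjoint `A`, `⟨A x, x⟩ + K ‖x‖²` is, for a suitable `K`, the square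
of a seminorm that satisfies the Cauchy-Schwarz inequality. -/
theorem exists_formSeminorm [CompleteSpace H] {A : H →ₗ.[𝕜] H} (hA : IsSelfAdjoint A)
    (hb : LowerSemibounded A) :
    ∃ (K : ℝ) (p : A.domain → ℝ), (∀ x, 0 ≤ p x) ∧
      (∀ x, p x ^ 2 = preForm A x + K * ‖(x : H)‖ ^ 2) ∧
      (∀ x y, |p x - p y| ≤ p (x - y)) ∧
      (∀ x y : A.domain, |RCLike.re (inner 𝕜 (x : H) (A y + (K : 𝕜) • (y : H)))| ≤ p x * p y) := by
  obtain ⟨c, hc⟩ := hb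
  have hsym : ∀ x y : A.domain, inner 𝕜 (A x) (y : H) = inner 𝕜 (x : H) (A y) := by
    have h := LinearPMap.adjoint_isFormalAdjoint hA.dense_domain
    rw [LinearPMap.isSelfAdjoint_def.1 hA] at h
    exact h
  let core : PreInnerProductSpace.Core 𝕜 A.domain :=
    { inner := fun x y => inner 𝕜 (x : H) (A y + ((-c : ℝ) : 𝕜) • (y : H))
      conj_inner_symm := fun x y => by
        simp only [inner_add_right, inner_smul_right, map_add, map_mul, inner_conj_symm, hsym,
          RCLike.conj_ofReal]
      re_inner_nonneg := fun x => by
        have := hc x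
        simp only [inner_add_right, inner_smul_right, map_add, RCLike.re_ofReal_mul,
          inner_self_eq_norm_sq, ← hsym]
        unfold preForm at this
        linarith
      add_left := fun x y z => by simp [inner_add_left]
      smul_left := fun x y r => by
        simp only [Submodule.coe_smul, inner_smul_left] }
  let S : SeminormedAddCommGroup A.domain :=
    InnerProductSpace.Core.toSeminormedAddCommGroup (𝕜 := 𝕜) (c := core)
  refine ⟨-c, fun x => S.norm x, fun x => @norm_nonneg _ S.toSeminormedAddGroup x, fun x => ?_,
    fun x y => @abs_norm_sub_norm_le _ S x y, fun x y => ?_⟩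
  · have h := InnerProductSpace.Core.inner_self_eq_norm_mul_norm (𝕜 := 𝕜) (c := core) x
    rw [pow_two]
    refine h.symm.trans ?_
    change RCLike.re (inner 𝕜 (x : H) (A x + ((-c : ℝ) : 𝕜) • (x : H))) = _
    simp only [inner_add_right, inner_smul_right, map_add, RCLike.re_ofReal_mul,
      inner_self_eq_norm_sq, ← hsym, preForm]
  · exact (RCLike.abs_re_le_norm _).trans
      (InnerProductSpace.Core.norm_inner_le_norm (𝕜 := 𝕜) (c := core) x y)

/-- The form of a lower semibounded self-adjoint operator is well defined: every approximating
sequence computes it. -/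
theorem FormApprox.tendsto_form [CompleteSpace H] {A : H →ₗ.[𝕜] H} (hA : IsSelfAdjoint A)
    (hb : LowerSemibounded A) {u : ℕ → A.domain} {x : H} (hu : FormApprox A u x) :
    Tendsto (fun n => preForm A (u n)) atTop (𝓝 (form A x)) := by
  obtain ⟨K, p, hp0, hp2, hpsub, hcs⟩ := exists_formSeminorm hA hb
  have hpC : ∀ {v : ℕ → A.domain} {y : H}, FormApprox A v y →
      Tendsto (fun q : ℕ × ℕ => p (v q.1 - v q.2)) atTop (𝓝 0) := by
    intro v y hv
    have h1 : Tendsto (fun q : ℕ × ℕ => (v q.1 : H)) atTop (𝓝 y) :=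
      hv.1.comp (by rw [← prod_atTop_atTop_eq]; exact tendsto_fst)
    have h2 : Tendsto (fun q : ℕ × ℕ => (v q.2 : H)) atTop (𝓝 y) :=
      hv.1.comp (by rw [← prod_atTop_atTop_eq]; exact tendsto_snd)
    have h3 : Tendsto (fun q : ℕ × ℕ => p (v q.1 - v q.2) ^ 2) atTop (𝓝 0) := by
      simp only [hp2]
      have h4 := hv.2.add ((((h1.sub h2).norm).pow 2).const_mul K)
      simpa using h4
    have h5 := (Real.continuous_sqrt.tendsto 0).comp h3
    simpa [Function.comp_def, Real.sqrt_sq (hp0 _)] using h5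
  have hlim : ∀ {v : ℕ → A.domain} {y : H}, FormApprox A v y →
      ∃ l, Tendsto (fun n => p (v n)) atTop (𝓝 l) := by
    intro v y hv
    apply cauchySeq_tendsto_of_complete
    rw [cauchySeq_iff_tendsto_dist_atTop_0]
    exact squeeze_zero (fun _ => dist_nonneg) (fun q => hpsub _ _) (hpC hv)
  have hconv : ∀ {v : ℕ → A.domain} {y : H}, FormApprox A v y →
      ∃ l, Tendsto (fun n => preForm A (v n)) atTop (𝓝 l) := by
    intro v y hv
    obtain ⟨l, hl⟩ := hlim hv
    refine ⟨l ^ 2 - K * ‖y‖ ^ 2, ?_⟩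
    have h := (hl.pow 2).sub (((hv.1.norm).pow 2).const_mul K)
    refine h.congr fun n => ?_
    rw [hp2]; ring
  have hsplit : ∀ a b : A.domain, p a ^ 2 = RCLike.re (inner 𝕜 (a : H)
      (A (a - b) + (K : 𝕜) • ((a - b : A.domain) : H)))
      + RCLike.re (inner 𝕜 (a : H) (A b + (K : 𝕜) • (b : H))) := by
    intro a b
    have h : A a - A b + ((K : 𝕜) • (a : H) - (K : 𝕜) • (b : H))
        + (A b + (K : 𝕜) • (b : H)) = A a + (K : 𝕜) • (a : H) := by abel
    rw [← map_add, ← inner_add_right, hp2, preForm, LinearPMap.map_sub, Submodule.coe_sub,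
      smul_sub, inner_re_symm, h, inner_add_right, inner_smul_right, map_add,
      RCLike.re_ofReal_mul, inner_self_eq_norm_sq]
  have hex : ∃ u : ℕ → A.domain, FormApprox A u x := ⟨u, hu⟩
  have hv := hex.choose_spec
  set v := hex.choose with hvdef
  have hform : form A x = limUnder atTop (fun n => preForm A (v n)) := by
    unfold form; rw [dif_pos hex]
  obtain ⟨lu, hlu⟩ := hlim hu
  obtain ⟨lv, hlv⟩ := hlim hv
  let w : ℕ → A.domain := fun n => u n - v n
  have hw0 : Tendsto (fun n => (w n : H)) atTop (𝓝 0) := by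
    simpa [w] using hu.1.sub hv.1
  have hpadd : ∀ x y : A.domain, p (x - y) ≤ p x + p y := by
    intro a b
    have h1 := abs_le.1 (hpsub (a - b) a)
    have h2 := abs_le.1 (hpsub 0 b)
    have h3 := abs_le.1 (hpsub b 0)
    have h4 := abs_le.1 (hpsub 0 (-b))
    have h5 := abs_le.1 (hpsub (-b) 0)
    have hz : p 0 = 0 := by
      have := hp2 0
      simpa [preForm] using this
    simp only [sub_sub_cancel_left, sub_zero, zero_sub, neg_neg] at *
    linarith [h1.1, h1.2, h2.1, h2.2, h3.1, h3.2, h4.1, h4.2, h5.1, h5.2]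
  have hwC : Tendsto (fun q : ℕ × ℕ => p (w q.1 - w q.2)) atTop (𝓝 0) := by
    have h := (hpC hu).add (hpC hv)
    rw [add_zero] at h
    refine squeeze_zero (fun _ => hp0 _) (fun q => ?_) h
    have : w q.1 - w q.2 = (u q.1 - u q.2) - (v q.1 - v q.2) := by simp only [w]; abel
    rw [this]
    exact hpadd _ _
  obtain ⟨l, hl⟩ : ∃ l, Tendsto (fun n => p (w n)) atTop (𝓝 l) := by
    apply cauchySeq_tendsto_of_complete
    rw [cauchySeq_iff_tendsto_dist_atTop_0]
    exact squeeze_zero (fun _ => dist_nonneg) (fun q => hpsub _ _) hwC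
  have hl0 : 0 ≤ l := ge_of_tendsto' hl fun n => hp0 _
  have hlz : l ≤ 0 := by
    by_contra hpos
    push Not at hpos
    have hev := hwC.eventually (gt_mem_nhds (half_pos hpos))
    obtain ⟨⟨N, M⟩, hN⟩ := eventually_atTop.1 hev
    set m := max N M
    have hB : Tendsto (fun n => RCLike.re (inner 𝕜 (w n : H) (A (w m) + (K : 𝕜) • (w m : H))))
        atTop (𝓝 0) := by
      have h := (RCLike.continuous_re.tendsto _).comp
        (hw0.inner (𝕜 := 𝕜) (tendsto_const_nhds (x := A (w m) + (K : 𝕜) • (w m : H))))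
      simpa [Function.comp_def] using h
    have hle : l ^ 2 ≤ l * (l / 2) + 0 := by
      refine le_of_tendsto_of_tendsto (hl.pow 2) ((hl.mul_const (l / 2)).add hB) ?_
      filter_upwards [eventually_ge_atTop m] with n hn
      have h1 : p (w n - w m) < l / 2 :=
        hN (n, m) ⟨(le_max_left _ _).trans hn, le_max_right _ _⟩
      have h2 := (le_abs_self _).trans (hcs (w n) (w n - w m))
      have h3 := hsplit (w n) (w m)
      have h4 := mul_le_mul_of_nonneg_left h1.le (hp0 (w n))
      linarith
    nlinarith
  have hlu_lv : lu = lv := by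
    have hz : l = 0 := le_antisymm hlz hl0
    subst hz
    have h1 := (hlu.sub hlv).abs
    have h2 := le_of_tendsto_of_tendsto' h1 hl fun n => hpsub (u n) (v n)
    exact sub_eq_zero.1 (abs_nonpos_iff.1 h2)
  obtain ⟨a, ha⟩ := hconv hv
  rw [hform, ha.limUnder_eq]
  have h1 := (hlu.pow 2).sub (((hu.1.norm).pow 2).const_mul K)
  have h2 := (hlv.pow 2).sub (((hv.1.norm).pow 2).const_mul K)
  have h3 : ∀ z : A.domain, p z ^ 2 - K * ‖(z : H)‖ ^ 2 = preForm A z := fun z => by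
    rw [hp2]; ring
  simp only [h3] at h1 h2
  rw [tendsto_nhds_unique ha h2, ← hlu_lv]
  exact h1

/-- The resolvent set of `A`: those `μ` for which `A - μ : D(A) → H` has a bounded everywhere
defined inverse `R`. -/
def resolventSet (A : H →ₗ.[𝕜] H) : Set 𝕜 :=
  {μ | ∃ R : H →L[𝕜] H,
    (∀ y : H, ∃ h : R y ∈ A.domain, A ⟨R y, h⟩ - μ • R y = y) ∧
    ∀ x : A.domain, R (A x - μ • (x : H)) = x}

/-- The spectrum of `A`. -/
def spec (A : H →ₗ.[𝕜] H) : Set 𝕜 := (resolventSet A)ᶜ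

/-- The space of all `x ∈ D(A)` with `A x = μ x`. -/
def eigenspace (A : H →ₗ.[𝕜] H) (μ : 𝕜) : Submodule 𝕜 H :=
  (LinearMap.ker (A.toFun - μ • A.domain.subtype)).map A.domain.subtype

/-- `A` has discrete spectrum: every point of the spectrum is an isolated point of the spectrum and
an eigenvalue of finite multiplicity. -/
def HasDiscreteSpectrum (A : H →ₗ.[𝕜] H) : Prop :=
  ∀ μ ∈ spec A,
    (∃ ε > 0, ∀ ν ∈ spec A, dist ν μ < ε → ν = μ) ∧
      eigenspace A μ ≠ ⊥ ∧ FiniteDimensional 𝕜 (eigenspace A μ)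

/-- The number of eigenvalues of `A` in `(-∞, t]`, counted with multiplicity: the dimension of the
sum of the (mutually orthogonal, if `A` is symmetric) eigenspaces. -/
def eigenvalueCount (A : H →ₗ.[𝕜] H) (t : ℝ) : Cardinal :=
  Module.rank 𝕜 (⨆ s : Set.Iic t, eigenspace A ((s : ℝ) : 𝕜) : Submodule 𝕜 H)

/-- The `k`-th eigenvalue (`k = 1, 2, …`, up to the dimension of `H`) of a lower semibounded
self-adjoint operator with discrete spectrum, in increasing order and counted with multiplicity:
the least `t` such that `A` has at least `k` eigenvalues in `(-∞, t]`. -/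
def orderedEigenvalue (A : H →ₗ.[𝕜] H) (k : ℕ) : ℝ :=
  sInf {t : ℝ | (k : Cardinal) ≤ eigenvalueCount A t}

end

end SelfAdjointForm

namespace SelfAdjointForm

noncomputable section

variable {𝕜 H : Type*} [RCLike 𝕜] [NormedAddCommGroup H] [InnerProductSpace 𝕜 H]

/-! Discreteness of the spectrum is a statement about forms: up to a finite rank correction, the
form exceeds every multiple of the squared norm. For `A₂`, `exists_sub_le_preForm` gives `q₂(y) ≥
τ‖y‖² - s‖P y‖²`, where `P` projects onto the finite-dimensional span of the eigenvectors with
eigenvalue at most `τ`. With (i) and (ii), putting `y = J x` yields a bound of the same kind for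
`q₁`, with the finite rank operator `P J`. Conversely, `hasDiscreteSpectrum_of_form_bound` recovers
discrete spectrum from such bounds.

The eigenvalue inequality is the min-max dimension count. Let `t ≥ 0` and `τ > (β/α) t`. If `x` lies
in the low eigenspaces of `A₁` up to `t` and `P J x = 0`, then `τ‖J x‖² ≤ q₂(J x) ≤ β q₁(x) ≤ β
t‖x‖² ≤ (β/α) t‖J x‖²`, so `x = 0`. Thus `P J` is injective there, and `A₂` has at least as many
eigenvalues up to `τ` as `A₁` has up to `t`.

No spectral theorem is used. Resolvent points are those where `A - μ` is bounded below
(`mem_resolventSet_iff`), and spectral gaps become norm bounds through `norm_apply_sub_ge_of_gap`.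
-/

theorem norm_apply_sub_real_smul_sq (A : H →ₗ.[𝕜] H) (r : ℝ) (x : A.domain) :
    ‖A x - (r : 𝕜) • (x : H)‖ ^ 2 = ‖A x‖ ^ 2 - 2 * r * preForm A x + r ^ 2 * ‖(x : H)‖ ^ 2 := by
  rw [norm_sub_sq (𝕜 := 𝕜), inner_smul_right, norm_smul, mul_pow, RCLike.re_ofReal_mul,
    RCLike.norm_ofReal, sq_abs, preForm]
  ring

theorem re_inner_apply_sub_smul (A : H →ₗ.[𝕜] H) (r : ℝ) (x : A.domain) :
    RCLike.re (inner 𝕜 (A x - (r : 𝕜) • (x : H)) (x : H)) = preForm A x - r * ‖(x : H)‖ ^ 2 := by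
  rw [inner_sub_left, inner_smul_left, map_sub, RCLike.conj_ofReal, RCLike.re_ofReal_mul,
    inner_self_eq_norm_sq, preForm]

theorem norm_apply_sub_ge_of_le_preForm {A : H →ₗ.[𝕜] H} {c : ℝ}
    (hc : ∀ x : A.domain, c * ‖(x : H)‖ ^ 2 ≤ preForm A x) (r : ℝ) (x : A.domain) :
    (c - r) * ‖(x : H)‖ ≤ ‖A x - (r : 𝕜) • (x : H)‖ := by
  have h1 := re_inner_apply_sub_smul A r x
  have h2 := re_inner_le_norm (𝕜 := 𝕜) (A x - (r : 𝕜) • (x : H)) x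
  rcases (norm_nonneg (x : H)).eq_or_lt with h0 | h0
  · rw [← h0, mul_zero]; exact norm_nonneg _
  · refine le_of_mul_le_mul_right ?_ h0
    nlinarith [hc x]

/-! ### Self-adjoint operators: maximality, closedness, resolvent set -/

section SelfAdjoint

variable [CompleteSpace H] {A : H →ₗ.[𝕜] H}

theorem inner_apply_left (hA : IsSelfAdjoint A) (x y : A.domain) :
    inner 𝕜 (A x) (y : H) = inner 𝕜 (x : H) (A y) := by
  have h := LinearPMap.adjoint_isFormalAdjoint hA.dense_domain
  rw [LinearPMap.isSelfAdjoint_def.1 hA] at h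
  exact h x y

/-- A self-adjoint operator has no proper symmetric extension, pointwise. -/
theorem mem_domain_of_inner_eq (hA : IsSelfAdjoint A) {x w : H}
    (h : ∀ y : A.domain, inner 𝕜 (A y) x = inner 𝕜 (y : H) w) :
    ∃ hx : x ∈ A.domain, A ⟨x, hx⟩ = w := by
  have h' : ∀ y : A.domain, inner 𝕜 w (y : H) = inner 𝕜 x (A y) := fun y => by
    rw [← inner_conj_symm, ← h y, inner_conj_symm]
  have key : ∃ hx : x ∈ A.adjoint.domain, A.adjoint ⟨x, hx⟩ = w :=
    ⟨LinearPMap.mem_adjoint_domain_of_exists x ⟨w, h'⟩,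
      LinearPMap.adjoint_apply_eq hA.dense_domain _ h'⟩
  rwa [LinearPMap.isSelfAdjoint_def.1 hA] at key

/-- A bounded symmetric perturbation of a self-adjoint operator is self-adjoint. -/
theorem isSelfAdjoint_vadd (hA : IsSelfAdjoint A) {B : H →ₗ[𝕜] H} (hB : B.IsSymmetric) :
    IsSelfAdjoint (B +ᵥ A) := by
  have hsymm : (B +ᵥ A).IsFormalAdjoint (B +ᵥ A) := fun x y => by
    have h := inner_apply_left hA x y
    simp only [LinearPMap.vadd_apply, inner_add_left, inner_add_right]
    rw [hB, h]
  have hdense : Dense ((B +ᵥ A).domain : Set H) := hA.dense_domain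
  refine LinearPMap.isSelfAdjoint_def.2 (LinearPMap.eq_of_le_of_domain_eq
    (hsymm.le_adjoint hdense) (le_antisymm (hsymm.le_adjoint hdense).1 fun x hx => ?_)).symm
  have hadj := LinearPMap.adjoint_isFormalAdjoint hdense ⟨x, hx⟩
  refine (mem_domain_of_inner_eq hA (w := (B +ᵥ A).adjoint ⟨x, hx⟩ - B x) fun y => ?_).1
  have h := congrArg (starRingEnd 𝕜) (hadj y)
  rw [inner_conj_symm, inner_conj_symm, LinearPMap.vadd_apply, inner_add_left, hB] at h
  rw [inner_sub_right, h]
  exact (add_sub_cancel_left _ _).symm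

/-- Closedness of `A`: pass to the limit in `⟨A y, uₙ⟩ = ⟨y, A uₙ⟩` and use maximality. -/
theorem mem_domain_of_tendsto (hA : IsSelfAdjoint A) {u : ℕ → A.domain} {x w : H}
    (hu : Tendsto (fun n => (u n : H)) atTop (𝓝 x)) (hw : Tendsto (fun n => A (u n)) atTop (𝓝 w)) :
    ∃ hx : x ∈ A.domain, A ⟨x, hx⟩ = w := by
  refine mem_domain_of_inner_eq hA fun y => ?_
  refine tendsto_nhds_unique ((tendsto_const_nhds (x := A y)).inner (𝕜 := 𝕜) hu) ?_
  simp only [inner_apply_left hA]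
  exact (tendsto_const_nhds (x := (y : H))).inner hw

theorem im_inner_apply_self (hA : IsSelfAdjoint A) (x : A.domain) :
    RCLike.im (inner 𝕜 (A x) (x : H)) = 0 := by
  rw [← RCLike.conj_eq_iff_im, inner_conj_symm, inner_apply_left hA]

theorem norm_apply_sub_smul_sq (hA : IsSelfAdjoint A) (μ : 𝕜) (x : A.domain) :
    ‖A x - μ • (x : H)‖ ^ 2
      = ‖A x - ((RCLike.re μ : ℝ) : 𝕜) • (x : H)‖ ^ 2 + RCLike.im μ ^ 2 * ‖(x : H)‖ ^ 2 := by
  have h := im_inner_apply_self hA x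
  rw [norm_sub_sq (𝕜 := 𝕜), norm_sub_sq (𝕜 := 𝕜), inner_smul_right, inner_smul_right, norm_smul,
    norm_smul, mul_pow, mul_pow, RCLike.norm_sq_eq_def (z := μ), RCLike.mul_re, h,
    RCLike.re_ofReal_mul, RCLike.norm_ofReal, sq_abs]
  ring

theorem norm_apply_sub_conj_smul (hA : IsSelfAdjoint A) (μ : 𝕜) (x : A.domain) :
    ‖A x - (starRingEnd 𝕜 μ) • (x : H)‖ = ‖A x - μ • (x : H)‖ := by
  rw [← sq_eq_sq₀ (norm_nonneg _) (norm_nonneg _), norm_apply_sub_smul_sq hA,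
    norm_apply_sub_smul_sq hA μ]
  simp

/-- A point belongs to the resolvent set of a self-adjoint operator `A` if and only if `A - μ` is
bounded below. -/
theorem mem_resolventSet_iff (hA : IsSelfAdjoint A) {μ : 𝕜} :
    μ ∈ resolventSet A ↔
      ∃ δ > 0, ∀ x : A.domain, δ * ‖(x : H)‖ ≤ ‖A x - μ • (x : H)‖ := by
  constructor
  · rintro ⟨R, -, hR⟩
    -- The `+ 1` covers `R = 0`, which occurs on the zero space.
    refine ⟨(‖R‖ + 1)⁻¹, by positivity, fun x => ?_⟩
    have h := R.le_opNorm (A x - μ • (x : H))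
    rw [hR] at h
    rw [inv_mul_le_iff₀ (by positivity)]
    nlinarith [norm_nonneg (A x - μ • (x : H))]
  · rintro ⟨δ, hδ, hbd⟩
    let L : A.domain →ₗ[𝕜] H := A.toFun - μ • A.domain.subtype
    have hL : ∀ x, L x = A x - μ • (x : H) := fun _ => rfl
    have hinj : Function.Injective L := by
      refine (injective_iff_map_eq_zero L).2 fun x hx => ?_
      have h := hbd x
      rw [← hL, hx, norm_zero] at h
      have : ‖(x : H)‖ ≤ 0 := by
        by_contra hpos
        exact absurd (mul_pos hδ (not_le.1 hpos)) (not_lt.2 h)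
      exact Subtype.ext (norm_le_zero_iff.1 this)
    have hclosed : IsClosed (LinearMap.range L : Set H) := by
      refine isClosed_of_closure_subset fun y hy => ?_
      obtain ⟨v, hv, hlim⟩ := mem_closure_iff_seq_limit.1 hy
      choose u hu using hv
      have hcau : CauchySeq fun n => (u n : H) := by
        rw [cauchySeq_iff_tendsto_dist_atTop_0]
        have h0 := (cauchySeq_iff_tendsto_dist_atTop_0.1 hlim.cauchySeq).const_mul δ⁻¹
        rw [mul_zero] at h0
        refine squeeze_zero (fun _ => dist_nonneg) (fun p => ?_) h0
        rw [le_inv_mul_iff₀ hδ, dist_eq_norm, dist_eq_norm, ← hu, ← hu, ← map_sub]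
        exact hbd (u p.1 - u p.2)
      obtain ⟨x, hx⟩ := cauchySeq_tendsto_of_complete hcau
      have hAu : Tendsto (fun n => A (u n)) atTop (𝓝 (y + μ • x)) := by
        refine (hlim.add (hx.const_smul μ)).congr fun n => ?_
        rw [← hu, hL, sub_add_cancel]
      obtain ⟨hxD, hAx⟩ := mem_domain_of_tendsto hA hx hAu
      exact ⟨⟨x, hxD⟩, by rw [hL, hAx]; exact add_sub_cancel_right _ _⟩
    -- The orthogonal complement of the range is the kernel of `A - conj μ`, which is trivial
    -- because `A - conj μ` obeys the same lower bound.
    have hrange : LinearMap.range L = ⊤ := by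
      have : CompleteSpace (LinearMap.range L) := hclosed.completeSpace_coe
      rw [← Submodule.orthogonal_eq_bot_iff, Submodule.eq_bot_iff]
      intro z hz
      have hz' : ∀ x : A.domain, inner 𝕜 (A x) z = inner 𝕜 (x : H) ((starRingEnd 𝕜 μ) • z) := by
        intro x
        have h := Submodule.inner_right_of_mem_orthogonal (LinearMap.mem_range_self L x) hz
        rw [hL, inner_sub_left, inner_smul_left, sub_eq_zero] at h
        rw [h, inner_smul_right]
      obtain ⟨hzD, hAz⟩ := mem_domain_of_inner_eq hA hz'
      have h := hbd ⟨z, hzD⟩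
      rw [← norm_apply_sub_conj_smul hA, hAz, sub_self, norm_zero] at h
      by_contra hne
      exact absurd (mul_pos hδ (norm_pos_iff.2 hne)) (not_lt.2 h)
    let e := LinearEquiv.ofBijective L ⟨hinj, LinearMap.range_eq_top.1 hrange⟩
    have he : ∀ y, L (e.symm y) = y := fun y => e.apply_symm_apply y
    refine ⟨(A.domain.subtype ∘ₗ e.symm.toLinearMap).mkContinuous δ⁻¹ fun y => ?_,
      fun y => ⟨(e.symm y).2, he y⟩, fun x => ?_⟩
    · rw [le_inv_mul_iff₀ hδ]
      have h := hbd (e.symm y)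
      rwa [← hL, he] at h
    · exact congrArg Subtype.val (e.symm_apply_apply x)

theorem ofReal_re_eq_of_mem_spec (hA : IsSelfAdjoint A) {μ : 𝕜} (hμ : μ ∈ spec A) :
    ((RCLike.re μ : ℝ) : 𝕜) = μ := by
  by_contra hne
  have him : RCLike.im μ ≠ 0 := fun h => hne (by
    apply RCLike.ext <;> simp [h])
  refine hμ ((mem_resolventSet_iff hA).2 ⟨|RCLike.im μ|, abs_pos.2 him, fun x => ?_⟩)
  refine le_of_sq_le_sq ?_ (norm_nonneg _)
  rw [norm_apply_sub_smul_sq hA, mul_pow, sq_abs]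
  exact le_add_of_nonneg_left (sq_nonneg _)

theorem isClosed_spec (hA : IsSelfAdjoint A) : IsClosed (spec A) := by
  rw [spec, isClosed_compl_iff, Metric.isOpen_iff]
  intro μ hμ
  obtain ⟨δ, hδ, h⟩ := (mem_resolventSet_iff hA).1 hμ
  refine ⟨δ, hδ, fun ν hν => (mem_resolventSet_iff hA).2 ⟨δ - dist ν μ, sub_pos.2 hν, fun x => ?_⟩⟩
  have h1 : A x - μ • (x : H) = (A x - ν • (x : H)) + (ν - μ) • (x : H) := by
    rw [sub_smul]; abel
  have h2 := (h x).trans (h1 ▸ norm_add_le _ _)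
  rw [norm_smul, ← dist_eq_norm ν μ] at h2
  linarith

/-- Points below the form bound are in the resolvent set. -/
theorem mem_resolventSet_of_lt (hA : IsSelfAdjoint A) {c r : ℝ}
    (hc : ∀ x : A.domain, c * ‖(x : H)‖ ^ 2 ≤ preForm A x) (hr : r < c) :
    (r : 𝕜) ∈ resolventSet A :=
  (mem_resolventSet_iff hA).2 ⟨c - r, sub_pos.2 hr, norm_apply_sub_ge_of_le_preForm hc r⟩

end SelfAdjoint

/-! ### Norm bounds from gaps in the spectrum -/

/-- If `T` is bounded and symmetric, then `T - ‖T‖` and `T + ‖T‖` are not both bounded below. -/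
theorem not_bounded_below_opNorm {T : H →L[𝕜] H} (hT : (T : H →ₗ[𝕜] H).IsSymmetric)
    (hT0 : 0 < ‖T‖) {a b : ℝ} (ha : 0 < a) (hb : 0 < b)
    (h1 : ∀ u, a * ‖u‖ ≤ ‖T u - (‖T‖ : 𝕜) • u‖) (h2 : ∀ u, b * ‖u‖ ≤ ‖T u + (‖T‖ : 𝕜) • u‖) :
    False := by
  set n := ‖T‖ with hn
  have hab : 0 < a * b := mul_pos ha hb
  -- `(T - n)(T + n) = T² - n²` is bounded below by `a b`; expand the square of its norm and use
  -- `‖T²u‖ ≤ n‖T u‖`.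
  have key : ∀ u, (a * b) ^ 2 * ‖u‖ ^ 2 + n ^ 2 * ‖T u‖ ^ 2 ≤ n ^ 4 * ‖u‖ ^ 2 := by
    intro u
    have e1 : T (T u + (n : 𝕜) • u) - (n : 𝕜) • (T u + (n : 𝕜) • u)
        = T (T u) - ((n ^ 2 : ℝ) : 𝕜) • u := by
      rw [map_add, map_smul, smul_add, smul_smul, RCLike.ofReal_pow, pow_two]; abel
    have e2 : a * b * ‖u‖ ≤ ‖T (T u) - ((n ^ 2 : ℝ) : 𝕜) • u‖ := by
      rw [← e1, mul_assoc]
      exact (mul_le_mul_of_nonneg_left (h2 u) ha.le).trans (h1 _)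
    have e3 : ‖T (T u) - ((n ^ 2 : ℝ) : 𝕜) • u‖ ^ 2
        = ‖T (T u)‖ ^ 2 - 2 * n ^ 2 * ‖T u‖ ^ 2 + n ^ 4 * ‖u‖ ^ 2 := by
      have hs : inner 𝕜 (T (T u)) u = inner 𝕜 (T u) (T u) := hT (T u) u
      rw [norm_sub_sq (𝕜 := 𝕜), inner_smul_right, norm_smul, mul_pow, RCLike.re_ofReal_mul,
        RCLike.norm_ofReal, sq_abs, hs, inner_self_eq_norm_sq]
      ring
    have e4 := pow_le_pow_left₀ (by positivity) e2 2
    have e5 := pow_le_pow_left₀ (norm_nonneg _) (T.le_opNorm (T u)) 2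
    rw [← hn, mul_pow] at e5
    rw [e3, mul_pow] at e4
    linarith
  set c := n ^ 2 - (a * b) ^ 2 / n ^ 2 with hc
  have hbound : ∀ u, ‖T u‖ ^ 2 ≤ c * ‖u‖ ^ 2 := by
    intro u
    have hn2 : 0 < n ^ 2 := by positivity
    refine le_of_mul_le_mul_left ?_ hn2
    have : n ^ 2 * (c * ‖u‖ ^ 2) = n ^ 4 * ‖u‖ ^ 2 - (a * b) ^ 2 * ‖u‖ ^ 2 := by
      rw [hc]; field_simp
    rw [this]
    linarith [key u]
  have hcn : c < n ^ 2 := sub_lt_self _ (by positivity)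
  have hle : n ≤ Real.sqrt c := by
    refine T.opNorm_le_bound (Real.sqrt_nonneg _) fun u => ?_
    rw [← Real.sqrt_sq (norm_nonneg (T u)), ← Real.sqrt_sq (norm_nonneg u),
      ← Real.sqrt_mul' _ (sq_nonneg _)]
    exact Real.sqrt_le_sqrt (hbound u)
  rw [Real.le_sqrt' hT0] at hle
  exact absurd hle (not_le.2 hcn)

/-- The polynomial identity `2 s² (s² - δ²) = s (s - δ) (s + δ)² + s (s + δ) (s - δ)²` for a
symmetric operator. -/
theorem norm_apply_apply_ge {D : Submodule 𝕜 H} {S : D →ₗ[𝕜] H}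
    (hS : ∀ x y : D, inner 𝕜 (S x) (y : H) = inner 𝕜 (x : H) (S y)) {δ : ℝ}
    (h1 : ∀ x : D, δ * RCLike.re (inner 𝕜 (S x) (x : H)) ≤ ‖S x‖ ^ 2)
    (h2 : ∀ x : D, -(δ * RCLike.re (inner 𝕜 (S x) (x : H))) ≤ ‖S x‖ ^ 2)
    (y : D) (hy : S y ∈ D) : δ * ‖S y‖ ≤ ‖S ⟨S y, hy⟩‖ := by
  have hb : inner 𝕜 (S ⟨S y, hy⟩) (y : H) = inner 𝕜 (S y) (S y) := hS ⟨S y, hy⟩ y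
  -- The test vectors are `(S + δ) y` and `-(S - δ) y`; the two inequalities are added at the end.
  have e1 := h1 ((δ : 𝕜) • y + ⟨S y, hy⟩)
  have e2 := h2 ((δ : 𝕜) • y - ⟨S y, hy⟩)
  simp only [map_add, map_sub, map_smul, Submodule.coe_add, Submodule.coe_sub, Submodule.coe_smul,
    inner_add_left, inner_add_right, inner_sub_left, inner_sub_right, inner_smul_left,
    inner_smul_right, hb, RCLike.conj_ofReal, RCLike.re_ofReal_mul, inner_self_eq_norm_sq,
    norm_add_sq (𝕜 := 𝕜), norm_sub_sq (𝕜 := 𝕜), norm_smul, mul_pow, RCLike.norm_ofReal,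
    sq_abs] at e1 e2
  refine le_of_sq_le_sq ?_ (norm_nonneg _)
  rw [mul_pow]
  rw [inner_re_symm (𝕜 := 𝕜) (S ⟨S y, hy⟩) (S y)] at e1 e2
  linarith

theorem mem_eigenspace_iff {A : H →ₗ.[𝕜] H} {μ : 𝕜} {x : H} :
    x ∈ eigenspace A μ ↔ ∃ hx : x ∈ A.domain, A ⟨x, hx⟩ = μ • x := by
  simp only [eigenspace, Submodule.mem_map, LinearMap.mem_ker]
  constructor
  · rintro ⟨y, hy, rfl⟩
    exact ⟨y.2, sub_eq_zero.1 hy⟩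
  · rintro ⟨hx, h⟩
    exact ⟨⟨x, hx⟩, sub_eq_zero.2 h, rfl⟩

section SelfAdjoint

variable [CompleteSpace H] {A : H →ₗ.[𝕜] H}

/-- The bound `‖(A - z)⁻¹‖ ≤ 1 / dist(z, σ(A))` for real `z`. -/
theorem norm_apply_sub_ge_of_gap (hA : IsSelfAdjoint A) {z ρ : ℝ} (hρ : 0 < ρ)
    (h : ∀ r : ℝ, |r - z| < ρ → (r : 𝕜) ∈ resolventSet A) (x : A.domain) :
    ρ * ‖(x : H)‖ ≤ ‖A x - (z : 𝕜) • (x : H)‖ := by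
  obtain ⟨R, hR1, hR2⟩ := h z (by simpa using hρ)
  choose hRD hR using hR1
  have hsymm : (R : H →ₗ[𝕜] H).IsSymmetric := by
    intro u v
    change inner 𝕜 (R u) v = inner 𝕜 u (R v)
    conv_lhs => rw [← hR v]
    conv_rhs => rw [← hR u]
    rw [inner_sub_right, inner_sub_left, inner_smul_right, inner_smul_left, RCLike.conj_ofReal]
    rw [← inner_apply_left hA ⟨R u, hRD u⟩ ⟨R v, hRD v⟩]
  -- With `R = (A - z)⁻¹`, one has `(A - z - 1/s) R = -(1/s)(R - s)`, so a lower bound for `A` at `z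
  -- + 1/s` passes to `R - s`.
  have hbelow : ∀ s : ℝ, s ≠ 0 → |s⁻¹| < ρ → ∃ η > 0, ∀ u, η * ‖u‖ ≤ ‖R u - (s : 𝕜) • u‖ := by
    intro s hs hsρ
    obtain ⟨δ, hδ, hd⟩ := (mem_resolventSet_iff hA).1 (h (z + s⁻¹) (by simpa using hsρ))
    have hs' : 0 < |s| := abs_pos.2 hs
    refine ⟨|s| / (1 + (δ * |s|)⁻¹), by positivity, fun u => ?_⟩
    have h1 := hd ⟨R u, hRD u⟩
    have h2 : A ⟨R u, hRD u⟩ - ((z + s⁻¹ : ℝ) : 𝕜) • R u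
        = -((s⁻¹ : ℝ) : 𝕜) • (R u - (s : 𝕜) • u) := by
      have h3 : ((s⁻¹ : ℝ) : 𝕜) • (s : 𝕜) • u = u := by
        rw [smul_smul, ← RCLike.ofReal_mul, inv_mul_cancel₀ hs, RCLike.ofReal_one, one_smul]
      rw [RCLike.ofReal_add, add_smul, ← sub_sub, hR u, neg_smul, smul_sub, h3]
      abel
    rw [h2, norm_smul, norm_neg, RCLike.norm_ofReal, abs_inv] at h1
    have h4 : ‖R u‖ ≤ (δ * |s|)⁻¹ * ‖R u - (s : 𝕜) • u‖ := by
      rw [mul_inv, mul_assoc, le_inv_mul_iff₀ hδ]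
      exact h1
    have h5 : |s| * ‖u‖ ≤ ‖R u - (s : 𝕜) • u‖ + ‖R u‖ := by
      have : |s| * ‖u‖ = ‖R u - (R u - (s : 𝕜) • u)‖ := by
        rw [sub_sub_cancel, norm_smul, RCLike.norm_ofReal]
      rw [this, add_comm]
      exact norm_sub_le _ _
    rw [div_mul_eq_mul_div, div_le_iff₀ (by positivity)]
    linarith
  -- If `‖R‖ > 1/ρ`, both points `z ± 1/‖R‖` lie in the gap, so `R - ‖R‖` and `R + ‖R‖` are both
  -- bounded below, which is impossible.
  have hnorm : ‖R‖ ≤ ρ⁻¹ := by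
    by_contra hlt
    rw [not_le] at hlt
    have hn : 0 < ‖R‖ := (inv_pos.2 hρ).trans hlt
    have hinv : ‖R‖⁻¹ < ρ := inv_lt_of_inv_lt₀ hρ hlt
    obtain ⟨a, ha, h1⟩ := hbelow ‖R‖ hn.ne' (by rwa [abs_of_pos (inv_pos.2 hn)])
    obtain ⟨b, hb, h2⟩ := hbelow (-‖R‖) (neg_ne_zero.2 hn.ne')
      (by rwa [inv_neg, abs_neg, abs_of_pos (inv_pos.2 hn)])
    refine not_bounded_below_opNorm hsymm hn ha hb h1 fun u => ?_
    have := h2 u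
    rwa [RCLike.ofReal_neg, neg_smul, sub_neg_eq_add] at this
  have h1 := R.le_of_opNorm_le hnorm (A x - (z : 𝕜) • (x : H))
  rwa [hR2, le_inv_mul_iff₀ hρ] at h1

/-- A self-adjoint operator with spectrum in `[t, ∞)` is bounded below by `t`. -/
theorem le_preForm_of_resolventSet (hA : IsSelfAdjoint A) {t : ℝ}
    (h : ∀ r < t, (r : 𝕜) ∈ resolventSet A) (x : A.domain) :
    t * ‖(x : H)‖ ^ 2 ≤ preForm A x := by
  by_contra hlt
  rw [not_le] at hlt
  set d := t * ‖(x : H)‖ ^ 2 - preForm A x with hd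
  have hd0 : 0 < d := sub_pos.2 hlt
  set m := ‖A x - (t : 𝕜) • (x : H)‖ ^ 2 with hm
  have hm0 : 0 ≤ m := sq_nonneg _
  -- The gap bound at `t - ρ`, squared, reads `ρ²‖x‖² ≤ m - 2ρd + ρ²‖x‖²`, i.e. `2ρd ≤ m`; this `ρ`
  -- makes `2ρd = m + 1`.
  set ρ := (m + 1) / (2 * d) with hρ
  have hρ0 : 0 < ρ := by positivity
  have h1 := norm_apply_sub_ge_of_gap hA (z := t - ρ) hρ0 (fun r hr => h r (by
    have := (abs_lt.1 hr).2
    linarith)) x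
  have h2 := pow_le_pow_left₀ (by positivity) h1 2
  have h3 : ρ * (2 * d) = m + 1 := by rw [hρ]; field_simp
  rw [norm_apply_sub_real_smul_sq] at h2
  rw [norm_apply_sub_real_smul_sq] at hm
  nlinarith

/-- If `μ` has distance at least `δ` from the rest of the spectrum, then `|A - μ| ≥ δ` on the
orthogonal complement of the eigenspace. -/
theorem norm_apply_sub_ge_of_isolated (hA : IsSelfAdjoint A) {μ δ : ℝ} (hδ : 0 < δ)
    (h : ∀ r : ℝ, r ≠ μ → |r - μ| < δ → (r : 𝕜) ∈ resolventSet A) (x : A.domain)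
    (hx : (x : H) ∈ (eigenspace A (μ : 𝕜))ᗮ) :
    δ * ‖(x : H)‖ ≤ ‖A x - (μ : 𝕜) • (x : H)‖ := by
  let S : A.domain →ₗ[𝕜] H := A.toFun - (μ : 𝕜) • A.domain.subtype
  have hSapp : ∀ x, S x = A x - (μ : 𝕜) • (x : H) := fun _ => rfl
  have hS : ∀ x y : A.domain, inner 𝕜 (S x) (y : H) = inner 𝕜 (x : H) (S y) := by
    intro x y
    rw [hSapp, hSapp, inner_sub_left, inner_sub_right, inner_smul_left, inner_smul_right,
      RCLike.conj_ofReal, inner_apply_left hA]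
  have hsq : ∀ (s : ℝ) (x : A.domain), ‖A x - ((μ + s : ℝ) : 𝕜) • (x : H)‖ ^ 2
      = ‖S x‖ ^ 2 - 2 * s * RCLike.re (inner 𝕜 (S x) (x : H)) + s ^ 2 * ‖(x : H)‖ ^ 2 := by
    intro s x
    have : A x - ((μ + s : ℝ) : 𝕜) • (x : H) = S x - (s : 𝕜) • (x : H) := by
      rw [hSapp, RCLike.ofReal_add, add_smul, sub_sub]
    rw [this, norm_sub_sq (𝕜 := 𝕜), inner_smul_right, norm_smul, mul_pow, RCLike.re_ofReal_mul,
      RCLike.norm_ofReal, sq_abs]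
    ring
  -- The interval of radius `δ/2` about `μ + δ/2` misses the spectrum; in the squared bound the
  -- terms `(δ/2)²‖x‖²` cancel.
  have h1 : ∀ x : A.domain, δ * RCLike.re (inner 𝕜 (S x) (x : H)) ≤ ‖S x‖ ^ 2 := by
    intro x
    have e := norm_apply_sub_ge_of_gap hA (z := μ + δ / 2) (half_pos hδ) (fun r hr => by
      rw [abs_lt] at hr
      exact h r (by rintro rfl; linarith) (abs_lt.2 ⟨by linarith, by linarith⟩)) x
    have e2 := pow_le_pow_left₀ (by positivity) e 2
    rw [hsq] at e2
    linarith
  have h2 : ∀ x : A.domain, -(δ * RCLike.re (inner 𝕜 (S x) (x : H))) ≤ ‖S x‖ ^ 2 := by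
    intro x
    have e := norm_apply_sub_ge_of_gap hA (z := μ + -(δ / 2)) (half_pos hδ) (fun r hr => by
      rw [abs_lt] at hr
      exact h r (by rintro rfl; linarith) (abs_lt.2 ⟨by linarith, by linarith⟩)) x
    have e2 := pow_le_pow_left₀ (by positivity) e 2
    rw [hsq] at e2
    linarith
  obtain ⟨R, hR1, hR2⟩ := h (μ + δ / 2) (by linarith)
    (by rw [add_sub_cancel_left, abs_of_pos (half_pos hδ)]; linarith)
  choose hRD hR using hR1
  set a : 𝕜 := ((δ / 2 : ℝ) : 𝕜) with ha
  have hRS : ∀ v, S ⟨R v, hRD v⟩ = v + a • R v := by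
    intro v
    have := hR v
    rw [RCLike.ofReal_add, add_smul, ← sub_sub, sub_eq_iff_eq_add] at this
    exact this
  have hRS' : ∀ x : A.domain, R (S x - a • (x : H)) = x := by
    intro x
    have := hR2 x
    rwa [RCLike.ofReal_add, add_smul, ← sub_sub] at this
  -- Writing `x = R w` with `R = (S - a)⁻¹` turns the claim into a closed condition on `w`. For `w =
  -- S v`, `R w = S (R v)` lies in the domain, where `norm_apply_apply_ge` applies.
  have hset : ∀ w ∈ closure (LinearMap.range S : Set H), δ * ‖R w‖ ≤ ‖w + a • R w‖ := by
    have hcl : IsClosed {w : H | δ * ‖R w‖ ≤ ‖w + a • R w‖} :=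
      isClosed_le (by fun_prop) (by fun_prop)
    refine fun w hw => closure_minimal ?_ hcl hw
    rintro _ ⟨v, rfl⟩
    have hmem : S ⟨R v, hRD v⟩ ∈ A.domain := by
      rw [hRS]
      exact A.domain.add_mem v.2 (A.domain.smul_mem _ (hRD v))
    have hv : v = (⟨S ⟨R v, hRD v⟩, hmem⟩ - a • ⟨R v, hRD v⟩ : A.domain) := by
      apply Subtype.ext
      rw [Submodule.coe_sub, Submodule.coe_smul]
      exact (sub_eq_iff_eq_add.2 (hRS v)).symm
    have e1 : S v = S ⟨S ⟨R v, hRD v⟩, hmem⟩ - a • S ⟨R v, hRD v⟩ := by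
      conv_lhs => rw [hv]
      rw [map_sub, map_smul]
    have e2 : R (S v) = S ⟨R v, hRD v⟩ := by
      rw [e1]
      exact hRS' ⟨S ⟨R v, hRD v⟩, hmem⟩
    have e3 := norm_apply_apply_ge hS h1 h2 ⟨R v, hRD v⟩ hmem
    change δ * ‖R (S v)‖ ≤ ‖S v + a • R (S v)‖
    rwa [e2, e1, sub_add_cancel]
  have hker : (LinearMap.range S)ᗮ ≤ eigenspace A (μ : 𝕜) := by
    intro z hz
    rw [mem_eigenspace_iff]
    refine mem_domain_of_inner_eq hA fun y => ?_
    have e := Submodule.inner_right_of_mem_orthogonal (LinearMap.mem_range_self S y) hz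
    rw [hSapp, inner_sub_left, inner_smul_left, RCLike.conj_ofReal, sub_eq_zero] at e
    rw [e, inner_smul_right]
  -- Both `x` and `S x` are orthogonal to the eigenspace, which contains the complement of the
  -- range.
  have hxw : S x - a • (x : H) ∈ closure (LinearMap.range S : Set H) := by
    rw [← Submodule.topologicalClosure_coe, SetLike.mem_coe,
      ← Submodule.orthogonal_orthogonal_eq_closure]
    refine Submodule.orthogonal_le hker ?_
    refine Submodule.sub_mem _ ?_ (Submodule.smul_mem _ _ hx)
    rw [Submodule.mem_orthogonal]
    intro e he
    obtain ⟨heD, hAe⟩ := mem_eigenspace_iff.1 he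
    have : S ⟨e, heD⟩ = 0 := by rw [hSapp, hAe, sub_self]
    rw [← hS ⟨e, heD⟩ x, this, inner_zero_left]
  have := hset _ hxw
  rwa [hRS', sub_add_cancel] at this

end SelfAdjoint

/-! ### Low eigenspaces and the form bound for discrete spectrum -/

/-- The sum of the eigenspaces of `A` for the eigenvalues in `(-∞, t]`. -/
def lowSpace (A : H →ₗ.[𝕜] H) (t : ℝ) : Submodule 𝕜 H :=
  ⨆ s : Set.Iic t, eigenspace A ((s : ℝ) : 𝕜)

theorem eigenvalueCount_eq (A : H →ₗ.[𝕜] H) (t : ℝ) :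
    eigenvalueCount A t = Module.rank 𝕜 (lowSpace A t) := rfl

theorem eigenspace_le_domain (A : H →ₗ.[𝕜] H) (μ : 𝕜) : eigenspace A μ ≤ A.domain :=
  fun _ hx => (mem_eigenspace_iff.1 hx).1

theorem lowSpace_le_domain (A : H →ₗ.[𝕜] H) (t : ℝ) : lowSpace A t ≤ A.domain :=
  iSup_le fun _ => eigenspace_le_domain A _

theorem eigenspace_le_lowSpace (A : H →ₗ.[𝕜] H) {r t : ℝ} (h : r ≤ t) :
    eigenspace A (r : 𝕜) ≤ lowSpace A t :=
  le_iSup (fun s : Set.Iic t => eigenspace A ((s : ℝ) : 𝕜)) ⟨r, h⟩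

theorem apply_mem_lowSpace (A : H →ₗ.[𝕜] H) {t : ℝ} {x : A.domain} (hx : (x : H) ∈ lowSpace A t) :
    A x ∈ lowSpace A t := by
  suffices h : ∃ hx : (x : H) ∈ A.domain, A ⟨x, hx⟩ ∈ lowSpace A t from h.2
  refine Submodule.iSup_induction _ (motive := fun y : H => ∃ hy : y ∈ A.domain,
    A ⟨y, hy⟩ ∈ lowSpace A t) hx (fun s y hy => ?_) ?_ ?_
  · obtain ⟨hyD, hAy⟩ := mem_eigenspace_iff.1 hy
    refine ⟨hyD, ?_⟩
    rw [hAy]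
    exact Submodule.smul_mem _ _ (Submodule.mem_iSup_of_mem s hy)
  · refine ⟨A.domain.zero_mem, ?_⟩
    rw [show (⟨0, A.domain.zero_mem⟩ : A.domain) = 0 from rfl, LinearPMap.map_zero]
    exact Submodule.zero_mem _
  · rintro y z ⟨hy, hAy⟩ ⟨hz, hAz⟩
    refine ⟨A.domain.add_mem hy hz, ?_⟩
    rw [show (⟨y + z, A.domain.add_mem hy hz⟩ : A.domain) = ⟨y, hy⟩ + ⟨z, hz⟩ from rfl,
      LinearPMap.map_add]
    exact Submodule.add_mem _ hAy hAz

theorem eigenspace_eq_bot_of_mem_resolventSet {A : H →ₗ.[𝕜] H} {μ : 𝕜}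
    (hμ : μ ∈ resolventSet A) : eigenspace A μ = ⊥ := by
  obtain ⟨R, -, hR⟩ := hμ
  rw [Submodule.eq_bot_iff]
  intro x hx
  obtain ⟨hxD, hAx⟩ := mem_eigenspace_iff.1 hx
  have := hR ⟨x, hxD⟩
  rw [hAx, sub_self, map_zero] at this
  exact this.symm

section SelfAdjoint

variable [CompleteSpace H] {A : H →ₗ.[𝕜] H}

theorem orthogonalFamily_eigenspace (hA : IsSelfAdjoint A) (t : ℝ) :
    OrthogonalFamily 𝕜 (fun s : Set.Iic t => eigenspace A ((s : ℝ) : 𝕜))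
      fun s => (eigenspace A ((s : ℝ) : 𝕜)).subtypeₗᵢ := by
  intro s r hsr x y
  obtain ⟨hx, hAx⟩ := mem_eigenspace_iff.1 x.2
  obtain ⟨hy, hAy⟩ := mem_eigenspace_iff.1 y.2
  have h := inner_apply_left hA ⟨x, hx⟩ ⟨y, hy⟩
  rw [hAx, hAy, inner_smul_left, inner_smul_right, RCLike.conj_ofReal] at h
  have hne : ((s : ℝ) : 𝕜) ≠ ((r : ℝ) : 𝕜) := fun e =>
    hsr (Subtype.ext (RCLike.ofReal_injective e))
  have h2 := sub_eq_zero.2 h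
  rw [← sub_mul] at h2
  exact (mul_eq_zero.1 h2).resolve_left (sub_ne_zero.2 hne)

/-- Expand `x` in orthogonal eigenvectors: the cross terms vanish and each eigenvalue is at most
`t`. -/
theorem preForm_le_of_mem_lowSpace (hA : IsSelfAdjoint A) {t : ℝ} {x : A.domain}
    (hx : (x : H) ∈ lowSpace A t) : preForm A x ≤ t * ‖(x : H)‖ ^ 2 := by
  classical
  have hV := orthogonalFamily_eigenspace hA t
  obtain ⟨f, hf⟩ := (Submodule.mem_iSup_iff_exists_dfinsupp' _ _).1 hx
  rw [DFinsupp.sum] at hf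
  let y : Set.Iic t → A.domain := fun s => ⟨f s, eigenspace_le_domain A _ (f s).2⟩
  have hxy : x = ∑ s ∈ f.support, y s := by
    apply Subtype.ext
    rw [← hf, Submodule.coe_sum]
  have hAy : ∀ s, A (y s) = ((s : ℝ) : 𝕜) • (f s : H) := fun s =>
    (mem_eigenspace_iff.1 (f s).2).2
  have hAx : A x = ∑ s ∈ f.support, (((((s : ℝ) : 𝕜) • f s :
      eigenspace A ((s : ℝ) : 𝕜))) : H) := by
    rw [hxy]
    refine (map_sum A.toFun y f.support).trans (Finset.sum_congr rfl fun s _ => ?_)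
    exact hAy s
  have h1 := hV.inner_sum (fun s => ((s : ℝ) : 𝕜) • f s) f f.support
  have h2 := hV.norm_sum f f.support
  simp only [Submodule.coe_subtypeₗᵢ, Submodule.coe_subtype] at h1 h2
  rw [hf] at h1 h2
  rw [← hAx] at h1
  rw [preForm, h1, h2, Finset.mul_sum, map_sum]
  refine Finset.sum_le_sum fun s _ => ?_
  rw [inner_smul_left, RCLike.conj_ofReal, RCLike.re_ofReal_mul, inner_self_eq_norm_sq]
  exact mul_le_mul_of_nonneg_right s.2 (sq_nonneg _)

/-- This set is closed and lies in the compact `[c, t]`; if infinite, it would accumulate at a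
non-isolated spectral point. -/
theorem finite_spec_le (hA : IsSelfAdjoint A) (hb : LowerSemibounded A)
    (hd : HasDiscreteSpectrum A) (t : ℝ) : {r : ℝ | r ≤ t ∧ (r : 𝕜) ∈ spec A}.Finite := by
  obtain ⟨c, hc⟩ := hb
  by_contra hinf
  have hsub : {r : ℝ | r ≤ t ∧ (r : 𝕜) ∈ spec A} ⊆ Set.Icc c t := fun r hr =>
    ⟨not_lt.1 fun h => hr.2 (mem_resolventSet_of_lt hA hc h), hr.1⟩
  obtain ⟨a, -, ha⟩ := Set.Infinite.exists_accPt_of_subset_isCompact hinf isCompact_Icc hsub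
  have hcl : IsClosed {r : ℝ | r ≤ t ∧ (r : 𝕜) ∈ spec A} :=
    isClosed_Iic.inter ((isClosed_spec hA).preimage RCLike.continuous_ofReal)
  have haS := isClosed_iff_clusterPt.1 hcl a ha.clusterPt
  obtain ⟨⟨ε, hε, hiso⟩, -⟩ := hd a haS.2
  rw [accPt_iff_frequently] at ha
  refine ha ?_
  filter_upwards [Metric.ball_mem_nhds a hε] with r hr
  rintro ⟨hra, hrS⟩
  refine hra (RCLike.ofReal_injective (hiso r hrS.2 ?_))
  rwa [dist_eq_norm, ← RCLike.ofReal_sub, RCLike.norm_ofReal, ← Real.dist_eq]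

theorem finiteDimensional_lowSpace (hA : IsSelfAdjoint A) (hb : LowerSemibounded A)
    (hd : HasDiscreteSpectrum A) (t : ℝ) : FiniteDimensional 𝕜 (lowSpace A t) := by
  set M := {r : ℝ | r ≤ t ∧ (r : 𝕜) ∈ spec A}
  have : Finite M := finite_spec_le hA hb hd t
  have : ∀ r : M, FiniteDimensional 𝕜 (eigenspace A ((r : ℝ) : 𝕜)) := fun r =>
    (hd _ r.2.2).2.2
  have hle : lowSpace A t ≤ ⨆ r : M, eigenspace A ((r : ℝ) : 𝕜) := by
    refine iSup_le fun s => ?_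
    by_cases hs : ((s : ℝ) : 𝕜) ∈ spec A
    · exact le_iSup (fun r : M => eigenspace A ((r : ℝ) : 𝕜)) ⟨s, s.2, hs⟩
    · rw [eigenspace_eq_bot_of_mem_resolventSet (not_not.1 hs)]
      exact bot_le
  exact Submodule.finiteDimensional_of_le hle

theorem apply_mem_orthogonal_lowSpace (hA : IsSelfAdjoint A) {t : ℝ} {x : A.domain}
    (hx : (x : H) ∈ (lowSpace A t)ᗮ) : A x ∈ (lowSpace A t)ᗮ := by
  rw [Submodule.mem_orthogonal]
  intro e he
  rw [← inner_apply_left hA ⟨e, lowSpace_le_domain A t he⟩ x]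
  exact Submodule.inner_right_of_mem_orthogonal (apply_mem_lowSpace A he) hx

/-- Up to a finite rank correction, an operator with discrete spectrum is bounded below by any
given constant. -/
theorem exists_sub_le_preForm (hA : IsSelfAdjoint A) (hb : LowerSemibounded A)
    (hd : HasDiscreteSpectrum A) (t : ℝ) [FiniteDimensional 𝕜 (lowSpace A t)] :
    ∃ s : ℝ, ∀ x : A.domain,
      t * ‖(x : H)‖ ^ 2 - s * ‖(lowSpace A t).starProjection x‖ ^ 2 ≤ preForm A x := by
  obtain ⟨c, hc⟩ := hb
  set E := lowSpace A t with hE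
  set P := E.starProjection with hP
  -- On `E` the operator is at least `c`, so adding `s` lifts it to at least `t + 1`, a margin of 1
  -- over every `r < t`.
  set s : ℝ := t - c + 1 with hs
  have hPsymm : (P : H →ₗ[𝕜] H).IsSymmetric := E.starProjection_isSymmetric
  have hsymm : ((s : 𝕜) • (P : H →ₗ[𝕜] H)).IsSymmetric := by
    intro x y
    simp only [LinearMap.smul_apply, inner_smul_left, inner_smul_right, RCLike.conj_ofReal]
    rw [hPsymm]
  have hA' := isSelfAdjoint_vadd hA hsymm
  have hres : ∀ r < t, (r : 𝕜) ∈ resolventSet (((s : 𝕜) • (P : H →ₗ[𝕜] H)) +ᵥ A) := by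
    intro r hr
    -- A spectral point `r < t` is isolated and its eigenspace lies in `E`, so on `Eᗮ` the operator
    -- is still bounded away from `r`.
    obtain ⟨δ, hδ, hbelow⟩ : ∃ δ > 0, ∀ x : A.domain, (x : H) ∈ Eᗮ →
        δ * ‖(x : H)‖ ≤ ‖A x - (r : 𝕜) • (x : H)‖ := by
      by_cases hr' : (r : 𝕜) ∈ spec A
      · obtain ⟨⟨ε, hε, hiso⟩, -⟩ := hd r hr'
        refine ⟨ε, hε, fun x hx => norm_apply_sub_ge_of_isolated hA hε (fun q hq hqr => ?_) x
          (Submodule.orthogonal_le (eigenspace_le_lowSpace A hr.le) hx)⟩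
        by_contra hq'
        refine hq (RCLike.ofReal_injective (hiso q hq' ?_))
        rwa [dist_eq_norm, ← RCLike.ofReal_sub, RCLike.norm_ofReal]
      · obtain ⟨δ, hδ, h⟩ := (mem_resolventSet_iff hA).1 (not_not.1 hr')
        exact ⟨δ, hδ, fun x _ => h x⟩
    refine (mem_resolventSet_iff hA').2 ⟨min 1 δ, lt_min one_pos hδ, fun x => ?_⟩
    have heE : P (x : H) ∈ E := E.starProjection_apply_mem _
    let e : A.domain := ⟨P (x : H), lowSpace_le_domain A t heE⟩
    let y : A.domain := (x : A.domain) - e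
    have hyE : (y : H) ∈ Eᗮ := E.sub_starProjection_mem_orthogonal (x : H)
    have hxey : (x : H) = (e : H) + (y : H) := (add_sub_cancel (e : H) (x : H)).symm
    have hAx : (((s : 𝕜) • (P : H →ₗ[𝕜] H)) +ᵥ A) x - (r : 𝕜) • (x : H)
        = (A e - ((r - s : ℝ) : 𝕜) • (e : H)) + (A y - (r : 𝕜) • (y : H)) := by
      have h1 : (((s : 𝕜) • (P : H →ₗ[𝕜] H)) +ᵥ A) x = (s : 𝕜) • (e : H) + A x := rfl
      have h2 : A x = A e + A y := by
        rw [← LinearPMap.map_add]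
        exact congrArg _ (Subtype.ext hxey)
      rw [h1, h2, hxey, RCLike.ofReal_sub, sub_smul, smul_add]
      abel
    have horth : inner 𝕜 (A e - ((r - s : ℝ) : 𝕜) • (e : H)) (A y - (r : 𝕜) • (y : H)) = 0 :=
      Submodule.inner_right_of_mem_orthogonal
        (E.sub_mem (apply_mem_lowSpace A heE) (E.smul_mem _ heE))
        (Eᗮ.sub_mem (apply_mem_orthogonal_lowSpace hA hyE) (Eᗮ.smul_mem _ hyE))
    have h1 : ‖(e : H)‖ ≤ ‖A e - ((r - s : ℝ) : 𝕜) • (e : H)‖ := by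
      refine le_trans ?_ (norm_apply_sub_ge_of_le_preForm hc (r - s) e)
      refine le_mul_of_one_le_left (norm_nonneg _) ?_
      rw [hs]; linarith
    have h2 := hbelow y hyE
    have h3 : ‖(x : H)‖ ^ 2 = ‖(e : H)‖ ^ 2 + ‖(y : H)‖ ^ 2 := by
      rw [hxey, sq, sq, sq]
      exact norm_add_sq_eq_norm_sq_add_norm_sq_of_inner_eq_zero _ _
        (Submodule.inner_right_of_mem_orthogonal heE hyE)
    have hm0 : 0 ≤ min 1 δ := (lt_min one_pos hδ).le
    have h1' : min 1 δ * ‖(e : H)‖ ≤ ‖A e - ((r - s : ℝ) : 𝕜) • (e : H)‖ :=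
      (mul_le_of_le_one_left (norm_nonneg _) (min_le_left _ _)).trans h1
    have h2' : min 1 δ * ‖(y : H)‖ ≤ ‖A y - (r : 𝕜) • (y : H)‖ :=
      (mul_le_mul_of_nonneg_right (min_le_right _ _) (norm_nonneg _)).trans h2
    refine le_of_sq_le_sq ?_ (norm_nonneg _)
    have h4 := norm_add_sq_eq_norm_sq_add_norm_sq_of_inner_eq_zero _ _ horth
    rw [← sq, ← sq, ← sq] at h4
    rw [hAx, h4, mul_pow, h3, mul_add, ← mul_pow, ← mul_pow]
    exact add_le_add (pow_le_pow_left₀ (by positivity) h1' 2)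
      (pow_le_pow_left₀ (by positivity) h2' 2)
  refine ⟨s, fun x => ?_⟩
  have h := le_preForm_of_resolventSet hA' hres x
  have h2 : preForm (((s : 𝕜) • (P : H →ₗ[𝕜] H)) +ᵥ A) x
      = s * ‖P (x : H)‖ ^ 2 + preForm A x := by
    have hPx : RCLike.re (inner 𝕜 (P (x : H)) (x : H)) = ‖P (x : H)‖ ^ 2 :=
      E.re_inner_starProjection_eq_normSq _
    have h1 : (((s : 𝕜) • (P : H →ₗ[𝕜] H)) +ᵥ A) x = (s : 𝕜) • P (x : H) + A x := rfl
    rw [preForm, h1, inner_add_left, inner_smul_left, RCLike.conj_ofReal, map_add,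
      RCLike.re_ofReal_mul, hPx, preForm]
  rw [h2] at h
  exact sub_le_iff_le_add'.2 h

end SelfAdjoint

/-! ### From form bounds back to discrete spectrum -/

section SelfAdjoint

variable [CompleteSpace H] {A : H →ₗ.[𝕜] H}
variable {G : Type*} [NormedAddCommGroup G] [NormedSpace 𝕜 G]

/-- `T` is injective on this space: `T x = 0` forces `t‖x‖² ≤ r‖x‖²` with `r < t`. -/
theorem finiteDimensional_lowSpace_of_form_bound (hA : IsSelfAdjoint A) {s t r : ℝ} (hrt : r < t)
    (T : H →L[𝕜] G) [FiniteDimensional 𝕜 T.range]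
    (h : ∀ x : A.domain, t * ‖(x : H)‖ ^ 2 - s * ‖T x‖ ^ 2 ≤ preForm A x) :
    FiniteDimensional 𝕜 (lowSpace A r) := by
  let L : lowSpace A r →ₗ[𝕜] T.range :=
    (T : H →ₗ[𝕜] G).rangeRestrict ∘ₗ (lowSpace A r).subtype
  refine FiniteDimensional.of_injective L ((injective_iff_map_eq_zero L).2 fun x hx => ?_)
  have hTx : T (x : H) = 0 := congrArg Subtype.val hx
  have h1 := h ⟨x, lowSpace_le_domain A r x.2⟩
  have h2 := preForm_le_of_mem_lowSpace hA (x := ⟨x, lowSpace_le_domain A r x.2⟩) x.2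
  simp only [hTx, norm_zero] at h1
  have h3 : (t - r) * ‖(x : H)‖ ^ 2 ≤ 0 := by
    simp only at h1 h2
    linarith
  by_contra hne
  have hpos : 0 < ‖(x : H)‖ := norm_pos_iff.2 fun e => hne (Subtype.ext e)
  exact absurd (mul_pos (sub_pos.2 hrt) (pow_pos hpos 2)) (not_lt.2 h3)

/-- Take unit vectors `uₙ` with `(A - r) uₙ → 0`. Finite rank makes `T uₙ` converge along a
subsequence; the form bound then makes that subsequence Cauchy, and its limit is an eigenvector. -/
theorem eigenspace_ne_bot_of_form_bound (hA : IsSelfAdjoint A) {s t r : ℝ} (hrt : r < t)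
    (T : H →L[𝕜] G) [FiniteDimensional 𝕜 T.range]
    (h : ∀ x : A.domain, t * ‖(x : H)‖ ^ 2 - s * ‖T x‖ ^ 2 ≤ preForm A x)
    (hr : (r : 𝕜) ∈ spec A) : eigenspace A (r : 𝕜) ≠ ⊥ := by
  have hex : ∀ n : ℕ, ∃ u : A.domain, ‖(u : H)‖ = 1 ∧
      ‖A u - (r : 𝕜) • (u : H)‖ ≤ 1 / ((n : ℝ) + 1) := by
    intro n
    by_contra hcon
    push Not at hcon
    refine hr ((mem_resolventSet_iff hA).2 ⟨1 / ((n : ℝ) + 1), by positivity, fun x => ?_⟩)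
    rcases eq_or_ne (x : H) 0 with h0 | h0
    · rw [h0, norm_zero, mul_zero]
      exact norm_nonneg _
    · have hpos : 0 < ‖(x : H)‖ := norm_pos_iff.2 h0
      have h1 := hcon (((‖(x : H)‖⁻¹ : ℝ) : 𝕜) • x) (by
        rw [Submodule.coe_smul, norm_smul, RCLike.norm_ofReal, abs_of_pos (inv_pos.2 hpos),
          inv_mul_cancel₀ hpos.ne'])
      rw [LinearPMap.map_smul, Submodule.coe_smul, smul_comm, ← smul_sub, norm_smul,
        RCLike.norm_ofReal, abs_of_pos (inv_pos.2 hpos), lt_inv_mul_iff₀ hpos] at h1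
      rw [mul_comm]
      exact h1.le
  choose u hu1 hu2 using hex
  have hw : Tendsto (fun n => A (u n) - (r : 𝕜) • (u n : H)) atTop (𝓝 0) :=
    squeeze_zero_norm hu2 tendsto_one_div_add_atTop_nhds_zero_nat
  have : ProperSpace T.range := FiniteDimensional.proper 𝕜 _
  obtain ⟨a, -, φ, hφ, hTφ⟩ := tendsto_subseq_of_bounded
    (Metric.isBounded_closedBall (x := (0 : T.range)) (r := ‖T‖))
    (x := fun n => (⟨T (u n), LinearMap.mem_range_self _ _⟩ : T.range)) (fun n => by
      rw [mem_closedBall_zero_iff]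
      have := T.le_opNorm (u n)
      rwa [hu1, mul_one] at this)
  have hT : Tendsto (fun n => T (u (φ n))) atTop (𝓝 (a : G)) :=
    (continuous_subtype_val.tendsto a).comp hTφ
  have hwφ := hw.comp hφ.tendsto_atTop
  have hcau : CauchySeq fun n => (u (φ n) : H) := by
    rw [cauchySeq_iff_tendsto_dist_atTop_0]
    have h1 := cauchySeq_iff_tendsto_dist_atTop_0.1 hwφ.cauchySeq
    have h2 := cauchySeq_iff_tendsto_dist_atTop_0.1 hT.cauchySeq
    -- For a difference `z` of unit vectors, `(t - r)‖z‖² ≤ 2‖(A - r) z‖ + s‖T z‖²`; the 2 bounds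
    -- `‖z‖`.
    have h3 := (((h1.const_mul 2).add ((h2.pow 2).const_mul s)).const_mul (t - r)⁻¹).sqrt
    simp only [mul_zero, ne_eq, OfNat.ofNat_ne_zero, not_false_eq_true, zero_pow, add_zero,
      Real.sqrt_zero] at h3
    refine squeeze_zero (fun _ => dist_nonneg) (fun p => Real.le_sqrt_of_sq_le ?_) h3
    rw [le_inv_mul_iff₀ (sub_pos.2 hrt)]
    set z : A.domain := u (φ p.1) - u (φ p.2) with hz
    have e1 : dist (u (φ p.1) : H) (u (φ p.2) : H) = ‖(z : H)‖ := dist_eq_norm _ _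
    have e2 : dist (T (u (φ p.1))) (T (u (φ p.2))) = ‖T z‖ := by
      rw [dist_eq_norm, ← map_sub]; rfl
    have e3 : dist (((fun n => A (u n) - (r : 𝕜) • (u n : H)) ∘ φ) p.1)
        (((fun n => A (u n) - (r : 𝕜) • (u n : H)) ∘ φ) p.2) = ‖A z - (r : 𝕜) • (z : H)‖ := by
      rw [dist_eq_norm, hz, LinearPMap.map_sub, Submodule.coe_sub, smul_sub]
      congr 1
      simp only [Function.comp_apply]
      abel
    rw [e1, e2, e3]
    have e4 := h z
    have e5 := re_inner_apply_sub_smul A r z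
    have e6 := re_inner_le_norm (𝕜 := 𝕜) (A z - (r : 𝕜) • (z : H)) z
    have e7 : ‖(z : H)‖ ≤ 2 := by
      refine (norm_sub_le _ _).trans ?_
      rw [hu1, hu1]; norm_num
    have e8 := mul_le_mul_of_nonneg_left e7 (norm_nonneg (A z - (r : 𝕜) • (z : H)))
    linarith
  obtain ⟨x, hx⟩ := cauchySeq_tendsto_of_complete hcau
  have hAu : Tendsto (fun n => A (u (φ n))) atTop (𝓝 ((r : 𝕜) • x)) := by
    have := hwφ.add (hx.const_smul (r : 𝕜))
    rw [zero_add] at this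
    exact this.congr fun n => sub_add_cancel _ _
  have hnorm : ‖x‖ = 1 := by
    refine tendsto_nhds_unique hx.norm ?_
    simp only [hu1]
    exact tendsto_const_nhds
  intro hbot
  have hmem := mem_eigenspace_iff.2 (mem_domain_of_tendsto hA hx hAu)
  rw [hbot, Submodule.mem_bot] at hmem
  rw [hmem, norm_zero] at hnorm
  exact zero_ne_one hnorm

/-- If, up to finite rank corrections, `A` is bounded below by every constant, then `A` has discrete
spectrum. -/
theorem hasDiscreteSpectrum_of_form_bound (hA : IsSelfAdjoint A)
    (h : ∀ t : ℝ, ∃ (s : ℝ) (T : H →L[𝕜] G), FiniteDimensional 𝕜 T.range ∧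
      ∀ x : A.domain, t * ‖(x : H)‖ ^ 2 - s * ‖T x‖ ^ 2 ≤ preForm A x) :
    HasDiscreteSpectrum A := by
  intro μ hμ
  obtain ⟨r, rfl⟩ : ∃ r : ℝ, (r : 𝕜) = μ := ⟨_, ofReal_re_eq_of_mem_spec hA hμ⟩
  -- The level `r + 2` leaves room to treat all spectral points up to `r + 1`: they are eigenvalues,
  -- finite in number, hence `r` is isolated.
  obtain ⟨s, T, hT, hbd⟩ := h (r + 2)
  have hfin := finiteDimensional_lowSpace_of_form_bound hA (r := r + 1) (by linarith) T hbd
  refine ⟨?_, eigenspace_ne_bot_of_form_bound hA (by linarith) T hbd hμ,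
    Submodule.finiteDimensional_of_le (eigenspace_le_lowSpace A (by linarith : r ≤ r + 1))⟩
  have hne : {q : Set.Iic (r + 1) | eigenspace A ((q : ℝ) : 𝕜) ≠ ⊥}.Finite := by
    let V : Set.Iic (r + 1) → Submodule 𝕜 (lowSpace A (r + 1)) := fun q =>
      (eigenspace A ((q : ℝ) : 𝕜)).comap (lowSpace A (r + 1)).subtype
    have hV : OrthogonalFamily 𝕜 (fun q => V q) fun q => (V q).subtypeₗᵢ :=
      fun p q hpq x y => orthogonalFamily_eigenspace hA (r + 1) hpq ⟨x, x.2⟩ ⟨y, y.2⟩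
    refine (WellFoundedGT.finite_ne_bot_of_iSupIndep hV.independent).subset fun q hq hVq => hq ?_
    rw [Submodule.eq_bot_iff] at hVq ⊢
    intro x hx
    exact congrArg Subtype.val (hVq ⟨x, eigenspace_le_lowSpace A q.2 hx⟩ hx)
  have hcl : IsClosed (Subtype.val '' {q : Set.Iic (r + 1) | eigenspace A ((q : ℝ) : 𝕜) ≠ ⊥}
      \ {r}) := (hne.image _).sdiff.isClosed
  obtain ⟨ε, hε, hball⟩ := Metric.isOpen_iff.1 hcl.isOpen_compl r (fun hr => hr.2 rfl)
  refine ⟨min ε 1, lt_min hε one_pos, fun ν hν hdist => ?_⟩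
  obtain ⟨q, rfl⟩ : ∃ q : ℝ, (q : 𝕜) = ν := ⟨_, ofReal_re_eq_of_mem_spec hA hν⟩
  rw [dist_eq_norm, ← RCLike.ofReal_sub, RCLike.norm_ofReal] at hdist
  have hq1 : q ≤ r + 1 := by
    have := (abs_lt.1 (hdist.trans_le (min_le_right _ _))).2
    linarith
  have hq := hball (Metric.mem_ball.2 (hdist.trans_le (min_le_left _ _)) : q ∈ Metric.ball r ε)
  by_contra hqr
  exact hq ⟨⟨⟨q, hq1⟩, eigenspace_ne_bot_of_form_bound hA (by linarith) T hbd hν, rfl⟩,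
    fun e => hqr (by rw [Set.mem_singleton_iff.1 e])⟩

end SelfAdjoint

/-! ### Form domain and existence of the ordered eigenvalues -/

theorem formApprox_const (A : H →ₗ.[𝕜] H) (x : A.domain) : FormApprox A (fun _ => x) x := by
  refine ⟨tendsto_const_nhds, ?_⟩
  simp [preForm]

theorem domain_subset_formDomain (A : H →ₗ.[𝕜] H) (x : A.domain) : (x : H) ∈ formDomain A :=
  ⟨_, formApprox_const A x⟩

section SelfAdjoint

variable [CompleteSpace H] {A : H →ₗ.[𝕜] H}

theorem form_eq_preForm (hA : IsSelfAdjoint A) (hb : LowerSemibounded A) (x : A.domain) :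
    form A x = preForm A x :=
  tendsto_nhds_unique ((formApprox_const A x).tendsto_form hA hb) tendsto_const_nhds

/-- A lower bound for the form on the operator domain extends to the form domain. -/
theorem le_form_of_le_preForm (hA : IsSelfAdjoint A) (hb : LowerSemibounded A) {g : H → ℝ}
    (hg : Continuous g) (h : ∀ x : A.domain, g x ≤ preForm A x) {y : H} (hy : y ∈ formDomain A) :
    g y ≤ form A y := by
  obtain ⟨u, hu⟩ := hy
  exact le_of_tendsto_of_tendsto' ((hg.tendsto y).comp hu.1) (hu.tendsto_form hA hb)
    fun n => h (u n)

theorem lowSpace_eq_bot_of_lt (hA : IsSelfAdjoint A) {c t : ℝ}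
    (hc : ∀ x : A.domain, c * ‖(x : H)‖ ^ 2 ≤ preForm A x) (ht : t < c) : lowSpace A t = ⊥ := by
  rw [lowSpace, iSup_eq_bot]
  exact fun s => eigenspace_eq_bot_of_mem_resolventSet
    (mem_resolventSet_of_lt hA hc (lt_of_le_of_lt s.2 ht))

/-- There are no eigenvalues below the form bound; for `k = 0` the set would be all of `ℝ`. -/
theorem bddBelow_eigenvalueCount (hA : IsSelfAdjoint A) (hb : LowerSemibounded A) {k : ℕ}
    (hk : 1 ≤ k) : BddBelow {t : ℝ | (k : Cardinal) ≤ eigenvalueCount A t} := by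
  obtain ⟨c, hc⟩ := hb
  refine ⟨c, fun t ht => not_lt.1 fun htc => ?_⟩
  rw [Set.mem_ofPred_eq, eigenvalueCount_eq, lowSpace_eq_bot_of_lt hA hc htc, rank_bot] at ht
  have : k ≤ 0 := by exact_mod_cast ht
  omega

/-- An operator with discrete spectrum has as many eigenvalues as the dimension of the space. -/
theorem exists_le_eigenvalueCount (hA : IsSelfAdjoint A) (hb : LowerSemibounded A)
    (hd : HasDiscreteSpectrum A) {k : ℕ} (hk : (k : Cardinal) ≤ Module.rank 𝕜 H) :
    ∃ t : ℝ, (k : Cardinal) ≤ eigenvalueCount A t := by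
  by_contra hcon
  push Not at hcon
  have hfd := finiteDimensional_lowSpace hA hb hd
  have hlt : ∀ t, Module.finrank 𝕜 (lowSpace A t) < k := fun t => by
    have h := hcon t
    rw [eigenvalueCount_eq, ← Module.finrank_eq_rank] at h
    exact_mod_cast h
  have hmono : ∀ {a b : ℝ}, a ≤ b → lowSpace A a ≤ lowSpace A b := fun hab =>
    iSup_le fun s => eigenspace_le_lowSpace A (le_trans s.2 hab)
  -- Bounded dimensions attain a maximum, so the low spaces are constant beyond `t₀`.
  obtain ⟨t₀, ht₀⟩ : ∃ t₀, ∀ t, Module.finrank 𝕜 (lowSpace A t)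
      ≤ Module.finrank 𝕜 (lowSpace A t₀) := by
    have hbdd : BddAbove (Set.range fun t => Module.finrank 𝕜 (lowSpace A t)) :=
      ⟨k, by rintro _ ⟨t, rfl⟩; exact (hlt t).le⟩
    obtain ⟨t₀, h₀⟩ := Nat.sSup_mem (Set.range_nonempty _) hbdd
    exact ⟨t₀, fun t => (le_csSup hbdd ⟨t, rfl⟩).trans h₀.ge⟩
  have heq : ∀ t, t₀ ≤ t → lowSpace A t = lowSpace A t₀ := fun t ht =>
    (Submodule.eq_of_le_of_finrank_le (hmono ht) (ht₀ t)).symm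
  have hzero : ∀ x : A.domain, (x : H) ∈ (lowSpace A t₀)ᗮ → (x : H) = 0 := by
    intro x hx
    by_contra hne
    have hpos : 0 < ‖(x : H)‖ ^ 2 := pow_pos (norm_pos_iff.2 hne) 2
    -- A level above the Rayleigh quotient of `x` contradicts the form bound, whose correction
    -- vanishes on `x`.
    set t := max t₀ (preForm A x / ‖(x : H)‖ ^ 2 + 1) with ht
    obtain ⟨s, hs⟩ := exists_sub_le_preForm hA hb hd t
    have h1 := hs x
    rw [(Submodule.starProjection_apply_eq_zero_iff _).2
      (by rwa [heq t (le_max_left _ _)]), norm_zero] at h1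
    have h2 : (preForm A x / ‖(x : H)‖ ^ 2 + 1) * ‖(x : H)‖ ^ 2 ≤ t * ‖(x : H)‖ ^ 2 :=
      mul_le_mul_of_nonneg_right (le_max_right _ _) hpos.le
    rw [add_mul, div_mul_cancel₀ _ hpos.ne'] at h2
    linarith
  have hdom : A.domain ≤ lowSpace A t₀ := by
    intro x hx
    have hP := (lowSpace A t₀).starProjection_apply_mem x
    have h := hzero (⟨x, hx⟩ - ⟨_, lowSpace_le_domain A t₀ hP⟩)
      ((lowSpace A t₀).sub_starProjection_mem_orthogonal x)
    rw [Submodule.coe_sub, sub_eq_zero] at h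
    rw [show x = _ from h]
    exact hP
  have htop : lowSpace A t₀ = ⊤ := by
    rw [← SetLike.coe_set_eq, Submodule.top_coe,
      ← (Submodule.closed_of_finiteDimensional (lowSpace A t₀)).closure_eq]
    exact (hA.dense_domain.mono hdom).closure_eq
  have h := hcon t₀
  rw [eigenvalueCount_eq, htop, rank_top] at h
  exact absurd hk (not_le.2 h)

end SelfAdjoint

/-! ### Comparison of the two operators -/

section Comparison

variable {H₁ H₂ : Type*}
    [NormedAddCommGroup H₁] [InnerProductSpace 𝕜 H₁] [CompleteSpace H₁]
    [NormedAddCommGroup H₂] [InnerProductSpace 𝕜 H₂] [CompleteSpace H₂]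
    {J : H₁ →L[𝕜] H₂} {A₁ : H₁ →ₗ.[𝕜] H₁} {A₂ : H₂ →ₗ.[𝕜] H₂} {α β : ℝ}

theorem hasDiscreteSpectrum_of_form_le (hA₁ : IsSelfAdjoint A₁) (hA₂ : IsSelfAdjoint A₂)
    (hb₁ : LowerSemibounded A₁) (hb₂ : LowerSemibounded A₂) (hd₂ : HasDiscreteSpectrum A₂)
    (hα : 0 < α) (hβ : 0 < β) (hi : ∀ x : H₁, α * ‖x‖ ^ 2 ≤ ‖J x‖ ^ 2)
    (hii : ∀ x ∈ formDomain A₁, J x ∈ formDomain A₂ ∧ form A₂ (J x) ≤ β * form A₁ x) :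
    HasDiscreteSpectrum A₁ := by
  refine hasDiscreteSpectrum_of_form_bound (G := H₂) hA₁ fun t => ?_
  -- Chosen so that `τ α = |t| β`; the absolute value keeps `τ ≥ 0`, needed to multiply (i) by `τ`.
  set τ := |t| * β / α with hτ
  have hτ0 : 0 ≤ τ := by positivity
  have := finiteDimensional_lowSpace hA₂ hb₂ hd₂ τ
  obtain ⟨s, hs⟩ := exists_sub_le_preForm hA₂ hb₂ hd₂ τ
  set P := (lowSpace A₂ τ).starProjection with hP
  refine ⟨s / β, P ∘L J, ?_, fun x => ?_⟩
  · refine Submodule.finiteDimensional_of_le (S₂ := lowSpace A₂ τ) ?_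
    rintro _ ⟨x, rfl⟩
    exact Submodule.starProjection_apply_mem _ _
  · obtain ⟨hJ, hle⟩ := hii x (domain_subset_formDomain A₁ x)
    rw [form_eq_preForm hA₁ hb₁] at hle
    have h1 := le_form_of_le_preForm hA₂ hb₂
      (g := fun y => τ * ‖y‖ ^ 2 - s * ‖P y‖ ^ 2) (by fun_prop) hs hJ
    have h2 : τ * (α * ‖(x : H₁)‖ ^ 2) ≤ τ * ‖J x‖ ^ 2 := mul_le_mul_of_nonneg_left (hi x) hτ0
    have h3 : τ * (α * ‖(x : H₁)‖ ^ 2) = β * (|t| * ‖(x : H₁)‖ ^ 2) := by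
      rw [hτ]; field_simp
    have h4 : β * (t * ‖(x : H₁)‖ ^ 2) ≤ β * (|t| * ‖(x : H₁)‖ ^ 2) :=
      mul_le_mul_of_nonneg_left (mul_le_mul_of_nonneg_right (le_abs_self t) (sq_nonneg _)) hβ.le
    refine le_of_mul_le_mul_left ?_ hβ
    rw [mul_sub, ← mul_assoc β (s / β), mul_div_cancel₀ s hβ.ne']
    change β * (t * ‖(x : H₁)‖ ^ 2) - s * ‖P (J x)‖ ^ 2 ≤ β * preForm A₁ x
    linarith

/-- The counting functions of two operators with comparable forms are comparable. -/
theorem le_eigenvalueCount_of_form_le (hA₁ : IsSelfAdjoint A₁) (hA₂ : IsSelfAdjoint A₂)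
    (hb₁ : LowerSemibounded A₁) (hb₂ : LowerSemibounded A₂) (hd₂ : HasDiscreteSpectrum A₂)
    (hα : 0 < α) (hβ : 0 < β) (hi : ∀ x : H₁, α * ‖x‖ ^ 2 ≤ ‖J x‖ ^ 2)
    (hii : ∀ x ∈ formDomain A₁, J x ∈ formDomain A₂ ∧ form A₂ (J x) ≤ β * form A₁ x)
    {k : ℕ} {t τ : ℝ} (ht : 0 ≤ t) (hτ : β / α * t < τ)
    (hk : (k : Cardinal) ≤ eigenvalueCount A₁ t) :
    (k : Cardinal) ≤ eigenvalueCount A₂ τ := by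
  have := finiteDimensional_lowSpace hA₂ hb₂ hd₂ τ
  rw [eigenvalueCount_eq] at hk ⊢
  let L : lowSpace A₁ t →ₗ[𝕜] lowSpace A₂ τ :=
    ((lowSpace A₂ τ).orthogonalProjectionOnto ∘L J).toLinearMap ∘ₗ (lowSpace A₁ t).subtype
  suffices hL : Function.Injective L by
    -- The two spaces may live in different universes, hence the lifts.
    have h := (Cardinal.lift_le.2 hk).trans (L.lift_rank_le_of_injective hL)
    rwa [Cardinal.lift_natCast, Cardinal.nat_le_lift_iff] at h
  refine (injective_iff_map_eq_zero L).2 fun x hx => ?_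
  have hPx : (lowSpace A₂ τ).starProjection (J x) = 0 := congrArg Subtype.val hx
  let y : A₁.domain := ⟨x, lowSpace_le_domain A₁ t x.2⟩
  obtain ⟨hJ, hle⟩ := hii y (domain_subset_formDomain A₁ y)
  rw [form_eq_preForm hA₁ hb₁] at hle
  obtain ⟨s, hs⟩ := exists_sub_le_preForm hA₂ hb₂ hd₂ τ
  have h1 := le_form_of_le_preForm hA₂ hb₂
    (g := fun z => τ * ‖z‖ ^ 2 - s * ‖(lowSpace A₂ τ).starProjection z‖ ^ 2) (by fun_prop) hs hJ
  have h2 := mul_le_mul_of_nonneg_left (preForm_le_of_mem_lowSpace hA₁ (x := y) x.2) hβ.le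
  have h3 : β * (t * ‖(x : H₁)‖ ^ 2) ≤ β / α * t * ‖J x‖ ^ 2 := by
    have h4 := mul_le_mul_of_nonneg_left (hi x) (by positivity : 0 ≤ β / α * t)
    refine le_trans (le_of_eq ?_) h4
    field_simp
  have hyx : (y : H₁) = x := rfl
  simp only [hyx, hPx, norm_zero] at h1 h2 hle
  have h5 : (τ - β / α * t) * ‖J x‖ ^ 2 ≤ 0 := by linarith
  have h6 : ‖J x‖ ^ 2 ≤ 0 := by
    by_contra hpos
    exact absurd (mul_pos (sub_pos.2 hτ) (not_le.1 hpos)) (not_lt.2 h5)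
  have h7 : ‖(x : H₁)‖ ^ 2 ≤ 0 := by
    by_contra hpos
    exact absurd (mul_pos hα (not_le.1 hpos)) (not_lt.2 ((hi x).trans h6))
  exact Subtype.ext (norm_eq_zero.1
    ((pow_eq_zero_iff two_ne_zero).1 (le_antisymm h7 (sq_nonneg _))))

theorem orderedEigenvalue_le_of_form_le (hA₁ : IsSelfAdjoint A₁) (hA₂ : IsSelfAdjoint A₂)
    (hb₁ : LowerSemibounded A₁) (hb₂ : LowerSemibounded A₂) (hd₂ : HasDiscreteSpectrum A₂)
    (hα : 0 < α) (hβ : 0 < β) (hi : ∀ x : H₁, α * ‖x‖ ^ 2 ≤ ‖J x‖ ^ 2)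
    (hii : ∀ x ∈ formDomain A₁, J x ∈ formDomain A₂ ∧ form A₂ (J x) ≤ β * form A₁ x)
    {k : ℕ} (hk : 1 ≤ k) (hkr : (k : Cardinal) ≤ Module.rank 𝕜 H₁)
    (h0 : 0 ≤ orderedEigenvalue A₁ k) :
    orderedEigenvalue A₂ k ≤ β / α * orderedEigenvalue A₁ k := by
  have hd₁ := hasDiscreteSpectrum_of_form_le hA₁ hA₂ hb₁ hb₂ hd₂ hα hβ hi hii
  have hq : 0 < β / α := div_pos hβ hα
  rw [← div_le_iff₀' hq]
  refine le_csInf (exists_le_eigenvalueCount hA₁ hb₁ hd₁ hkr) fun t ht => ?_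
  rw [div_le_iff₀' hq]
  -- Nonnegativity of the infimum passes to every competing level, as the counting comparison
  -- requires.
  have ht0 : 0 ≤ t := h0.trans (csInf_le (bddBelow_eigenvalueCount hA₁ hb₁ hk) ht)
  -- The counting comparison needs `τ` strictly above `(β/α) t`, so all such `τ` are used.
  refine le_of_forall_gt_imp_ge_of_dense fun τ hτ => ?_
  exact csInf_le (bddBelow_eigenvalueCount hA₂ hb₂ hk)
    (le_eigenvalueCount_of_form_le hA₁ hA₂ hb₁ hb₂ hd₂ hα hβ hi hii ht0 hτ ht)

end Comparison

end

end SelfAdjointForm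

theorem proposition2p1 {𝕜 H₁ H₂ : Type*} [RCLike 𝕜]
    [NormedAddCommGroup H₁] [InnerProductSpace 𝕜 H₁] [CompleteSpace H₁]
    [NormedAddCommGroup H₂] [InnerProductSpace 𝕜 H₂] [CompleteSpace H₂]
    (J : H₁ →L[𝕜] H₂) (hJ : Function.Injective J)
    (A₁ : H₁ →ₗ.[𝕜] H₁) (A₂ : H₂ →ₗ.[𝕜] H₂)
    (hA₁ : IsSelfAdjoint A₁) (hA₂ : IsSelfAdjoint A₂)
    (hb₁ : SelfAdjointForm.LowerSemibounded A₁) (hb₂ : SelfAdjointForm.LowerSemibounded A₂)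
    (hd₂ : SelfAdjointForm.HasDiscreteSpectrum A₂)
    (α β : ℝ) (hα : 0 < α) (hβ : 0 < β)
    (hi : ∀ x : H₁, α * ‖x‖ ^ 2 ≤ ‖J x‖ ^ 2)
    (hii : ∀ x ∈ SelfAdjointForm.formDomain A₁,
      J x ∈ SelfAdjointForm.formDomain A₂ ∧
        SelfAdjointForm.form A₂ (J x) ≤ β * SelfAdjointForm.form A₁ x) :
    SelfAdjointForm.HasDiscreteSpectrum A₁ ∧
      ∀ k : ℕ, 1 ≤ k → (k : Cardinal) ≤ Module.rank 𝕜 H₁ →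
        0 ≤ SelfAdjointForm.orderedEigenvalue A₁ k →
        SelfAdjointForm.orderedEigenvalue A₂ k
          ≤ β / α * SelfAdjointForm.orderedEigenvalue A₁ k :=
  ⟨SelfAdjointForm.hasDiscreteSpectrum_of_form_le hA₁ hA₂ hb₁ hb₂ hd₂ hα hβ hi hii,
    fun _ hk hkr h0 => SelfAdjointForm.orderedEigenvalue_le_of_form_le hA₁ hA₂ hb₁ hb₂ hd₂ hα hβ
      hi hii hk hkr h0⟩
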